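/- Let $f:\mathbb R^n\to\mathbb R$ ($n\ge 1$) be convex and differentiable, let $\nabla f$ be Lipschitz with constant $L$ in the Euclidean norm, and suppose that for every $i\in\{1,\dots,n\}$, $x\in\mathbb R^n$, $u\in\mathbb R$ one has $|\nabla_i f(x+ue_i)-\nabla_i f(x)|\le L_i|u|$. Let $x_*$ be a minimizer of $f$ on $\mathbb R^n$, let $x_0\in\mathbb R^n$, $H>0$, $\varepsilon>0$, $0<\delta<1$, and put $Z=\sum_{i=1}^n(H+L_i)$. The accelerated meta-algorithm with coordinate descent as its inner method is the following. Put $\lambda=\frac1{2H}$, $A_0=0$, $v_0=x_0$. For $k=0,\dots,\widetilde N-1$ put $$a_{k+1}=\frac{\lambda+\sqrt{\lambda^2+4\lambda A_k}}2,\qquad A_{k+1}=A_k+a_{k+1},\qquad \widetilde x_k=\frac{A_kv_k+a_{k+1}x_k}{A_{k+1}},$$ let $v_{k+1}$ be the result of $N_\delta$ iterations of randomized coordinate descent, started at $y_0=\widetilde x_k$, on the auxiliary function $F_k(y)=f(y)+\frac H2\|y-\widetilde x_k\|_2^2$, and put $x_{k+1}=x_k-a_{k+1}\nabla f(v_{k+1})$.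 Each iteration of coordinate descent draws an index $i$, independently of all other draws, with probability $(H+L_i)/Z$, replaces the $i$-th coordinate $y^i$ of the current point $y$ by $y^i-\frac1{H+L_i}\nabla_iF_k(y)$, and leaves the other coordinates unchanged. Then $$\Pr\bigl(f(v_{\widetilde N})-f(x_*)<\varepsilon\bigr)\ge 1-\delta$$ provided that $$\widetilde N\ge\left\lceil\frac{4\sqrt{15}}5\sqrt{\frac{H\|x_0-x_*\|_2^2}\varepsilon}\,\right\rceil,\qquad N_\delta\ge\left\lceil\frac ZH\,\ln\left\{\frac{\widetilde N}\delta\left(1+\frac LH\right)\left(3+\frac{2L}H\right)^2\right\}\right\rceil.$$ (If $\widetilde N=0$, which the first condition allows only when $x_0=x_*$, the second condition is not needed.) -/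

import Mathlib

noncomputable section

/-- The auxiliary prox-objective `F(y) = f(y) + (H/2) ‖y - c‖²` with prox-centre `c`. -/
def auxObjective {n : ℕ} (f : EuclideanSpace ℝ (Fin n) → ℝ) (H : ℝ)
    (c : EuclideanSpace ℝ (Fin n)) (y : EuclideanSpace ℝ (Fin n)) : ℝ :=
  f y + H / 2 * ‖y - c‖ ^ 2

/-- One coordinate descent step on `F`: only the coordinate `i` of `y` changes, and its new value
is `y i - (∇F(y)) i / β i`. -/
def coordStep {n : ℕ} (F : EuclideanSpace ℝ (Fin n) → ℝ) (β : Fin n → ℝ)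
    (y : EuclideanSpace ℝ (Fin n)) (i : Fin n) : EuclideanSpace ℝ (Fin n) :=
  y - EuclideanSpace.single i (1 / β i * gradient F y i)

/-- The coordinate descent method on `F` started at `y₀`: the iterate after `N` steps, when the
coordinate used in step `j` is `s j`. -/
def coordDescent {n : ℕ} (F : EuclideanSpace ℝ (Fin n) → ℝ) (β : Fin n → ℝ)
    (y₀ : EuclideanSpace ℝ (Fin n)) (s : ℕ → Fin n) : ℕ → EuclideanSpace ℝ (Fin n)
  | 0 => y₀
  | N + 1 => coordStep F β (coordDescent F β y₀ s N) (s N)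

/-- The state `(A_k, x_k, v_k)` of the accelerated meta-algorithm. -/
structure MetaState (n : ℕ) where
  /-- the accumulated weight `A_k` -/
  A : ℝ
  /-- the point `x_k` -/
  x : EuclideanSpace ℝ (Fin n)
  /-- the point `v_k` -/
  v : EuclideanSpace ℝ (Fin n)

/-- The weight `a_{k+1} = (lam + √(lam² + 4 lam A_k)) / 2`. -/
def metaWeight (lam A : ℝ) : ℝ :=
  (lam + √(lam ^ 2 + 4 * lam * A)) / 2

/-- The extrapolated point `(A_k v_k + a_{k+1} x_k) / A_{k+1}`. -/
def metaCentre {n : ℕ} (lam : ℝ) (S : MetaState n) : EuclideanSpace ℝ (Fin n) :=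
  (S.A + metaWeight lam S.A)⁻¹ • (S.A • S.v + metaWeight lam S.A • S.x)

/-- One iteration of the accelerated meta-algorithm, with `lam = 1 / (2 H)`. `inner c` is the output
of the inner method on the auxiliary problem with prox-centre `c`. -/
def metaStep {n : ℕ} (f : EuclideanSpace ℝ (Fin n) → ℝ) (H : ℝ)
    (inner : EuclideanSpace ℝ (Fin n) → EuclideanSpace ℝ (Fin n)) (S : MetaState n) :
    MetaState n :=
  let lam : ℝ := 1 / (2 * H)
  let a : ℝ := metaWeight lam S.A
  let v' : EuclideanSpace ℝ (Fin n) := inner (metaCentre lam S)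
  { A := S.A + a
    x := S.x - a • gradient f v'
    v := v' }

/-- The accelerated meta-algorithm started at `x₀`, whose auxiliary problems are solved by `N` steps
of coordinate descent with step sizes `1 / (H + Lc i)`, started at the prox-centre. The coordinate
used in inner step `j` of outer iteration `k` is `s k j`. -/
def metaRun {n : ℕ} (f : EuclideanSpace ℝ (Fin n) → ℝ) (H : ℝ) (Lc : Fin n → ℝ)
    (x₀ : EuclideanSpace ℝ (Fin n)) (N : ℕ) (s : ℕ → ℕ → Fin n) : ℕ → MetaState n
  | 0 => { A := 0, x := x₀, v := x₀ }
  | k + 1 =>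
      metaStep f H (fun c => coordDescent (auxObjective f H c) (fun i => H + Lc i) c (s k) N)
        (metaRun f H Lc x₀ N s k)

end

/-! Two mechanisms are coupled by an inexactness criterion. Write `c` for a prox-centre, `F` for its
auxiliary objective and `m` for the minimizer of `F`. Outer loop: if every inner output `v`
satisfies `‖∇F(v)‖ ≤ H‖v - c‖`, the potential `A_k (f(v_k) - f(x_*)) + ‖x_k - x_*‖²/2` never
increases (`metaStep_potential_le`). Since `A_k ≥ k²/(8H)`, this gives `f(v_k) - f(x_*) ≤ 4H‖x_0 -
x_*‖²/k²`. The required `Ñ` has `48/5` in place of `4`, so the final inequality is strict. Inner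
loop: `F` is `H`-strongly convex, and a step on coordinate `i` gains `(∇_i F)²/(2(H+L_i))`. Sampling
proportionally to `H+L_i` makes the expected gain `‖∇F‖²/(2Z)`, so the Polyak–Łojasiewicz inequality
contracts the expected residual by `1 - H/Z`. Link: reducing the residual by `C = (1+L/H)(3+2L/H)²`
implies the criterion (`norm_gradient_auxObjective_le_of_residual`). Markov's inequality bounds the
failure probability of one outer iteration by `δ/Ñ`, and a union bound finishes. The centres are
random. Dividing the residual by its value at the centre gives a quantity whose expectation is
bounded by integrating out one draw at a time, without conditional expectations. -/

section Smooth

/-! ### Gradient inequalities in a Hilbert space -/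

open scoped RealInnerProductSpace

variable {E : Type*} [NormedAddCommGroup E] [InnerProductSpace ℝ E] [CompleteSpace E]

lemma hasDerivAt_comp_line {F : E → ℝ} (hF : Differentiable ℝ F) (y d : E) (t : ℝ) :
    HasDerivAt (fun u : ℝ => F (y + u • d)) ⟪gradient F (y + t • d), d⟫ t := by
  have h1 : HasDerivAt (fun u : ℝ => y + u • d) d t := by
    simpa using ((hasDerivAt_id t).smul_const d).const_add y
  rw [inner_gradient_left]
  exact (hF _).hasFDerivAt.comp_hasDerivAt t h1

/-- The descent lemma along a segment. -/
lemma le_of_inner_gradient_sub_le {F : E → ℝ} (hF : Differentiable ℝ F) (y d : E) (M : ℝ)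
    (h : ∀ t : ℝ, 0 < t → ⟪gradient F (y + t • d) - gradient F y, d⟫ ≤ M * t) :
    F (y + d) ≤ F y + ⟪gradient F y, d⟫ + M / 2 := by
  -- Subtracting the quadratic model leaves a function of `t` with nonpositive derivative for `t >
  -- 0`; its values at `0` and `1` are compared.
  have hd (t : ℝ) : HasDerivAt
      (fun u : ℝ => F (y + u • d) - (⟪gradient F y, d⟫ * u + M / 2 * u ^ 2))
      (⟪gradient F (y + t • d), d⟫ - (⟪gradient F y, d⟫ + M * t)) t := by
    refine (hasDerivAt_comp_line hF y d t).sub ((HasDerivAt.const_mul _ (hasDerivAt_id t)).add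
      ((((hasDerivAt_id t).pow 2).const_mul (M / 2))) |>.congr_deriv ?_)
    simp only [id_eq]
    ring
  have hanti : AntitoneOn
      (fun u : ℝ => F (y + u • d) - (⟪gradient F y, d⟫ * u + M / 2 * u ^ 2)) (Set.Ici 0) := by
    apply antitoneOn_of_deriv_nonpos (convex_Ici 0)
    · exact fun t _ => (hd t).continuousAt.continuousWithinAt
    · exact fun t _ => (hd t).differentiableAt.differentiableWithinAt
    · intro t ht
      rw [interior_Ici, Set.mem_Ioi] at ht
      have := h t ht
      rw [inner_sub_left] at this
      rw [(hd t).deriv]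
      linarith
  have := hanti (Set.mem_Ici.2 le_rfl) (Set.mem_Ici.2 zero_le_one) zero_le_one
  simp only [one_smul, zero_smul, add_zero, mul_one, mul_zero, one_pow, ne_eq, OfNat.ofNat_ne_zero,
    not_false_eq_true, zero_pow, sub_zero] at this
  linarith

lemma ConvexOn.add_inner_gradient_le {f : E → ℝ} (hconv : ConvexOn ℝ Set.univ f)
    (hdiff : Differentiable ℝ f) (x y : E) : f x + ⟪gradient f x, y - x⟫ ≤ f y := by
  have hc : ConvexOn ℝ Set.univ (fun u : ℝ => f (x + u • (y - x))) := by
    have := hconv.comp_affineMap (AffineMap.lineMap x y : ℝ →ᵃ[ℝ] E)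
    rw [Set.preimage_univ] at this
    refine this.congr fun u _ => ?_
    simp [AffineMap.lineMap_apply, add_comm]
  have h0 := hasDerivAt_comp_line hdiff x (y - x) 0
  have := hc.le_slope_of_hasDerivAt (Set.mem_univ 0) (Set.mem_univ 1) zero_lt_one h0
  simp only [slope_def_field, zero_smul, one_smul, add_zero, add_sub_cancel, sub_zero, div_one]
    at this
  linarith

end Smooth

/-! ### The auxiliary prox-problem and its accuracy criterion -/

section AuxObjective

open scoped RealInnerProductSpace

variable {n : ℕ} {f : EuclideanSpace ℝ (Fin n) → ℝ} {H L : ℝ}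
  {c x y m : EuclideanSpace ℝ (Fin n)}

lemma hasGradientAt_auxObjective (hdiff : Differentiable ℝ f)
    (c y : EuclideanSpace ℝ (Fin n)) :
    HasGradientAt (auxObjective f H c) (gradient f y + H • (y - c)) y := by
  have h1 := (hdiff y).hasGradientAt.hasFDerivAt
  have h2 := (((hasFDerivAt_id (𝕜 := ℝ) y).sub_const c).norm_sq).const_mul (H / 2)
  rw [hasGradientAt_iff_hasFDerivAt]
  refine (h1.add h2).congr_fderiv ?_
  ext z
  simp
  ring

lemma gradient_auxObjective (hdiff : Differentiable ℝ f) (c y : EuclideanSpace ℝ (Fin n)) :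
    gradient (auxObjective f H c) y = gradient f y + H • (y - c) :=
  (hasGradientAt_auxObjective hdiff c y).gradient

lemma differentiable_auxObjective (hdiff : Differentiable ℝ f)
    (c : EuclideanSpace ℝ (Fin n)) : Differentiable ℝ (auxObjective f H c) :=
  fun y => (hasGradientAt_auxObjective hdiff c y).differentiableAt

/-- Strong convexity of the auxiliary objective. -/
lemma auxObjective_strong_convex (hdiff : Differentiable ℝ f) (hconv : ConvexOn ℝ Set.univ f)
    (c x y : EuclideanSpace ℝ (Fin n)) :
    auxObjective f H c x + ⟪gradient (auxObjective f H c) x, y - x⟫ + H / 2 * ‖y - x‖ ^ 2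
      ≤ auxObjective f H c y := by
  have h := hconv.add_inner_gradient_le hdiff x y
  have h2 : y - c = (x - c) + (y - x) := by abel
  rw [gradient_auxObjective hdiff, auxObjective, auxObjective, h2, norm_add_sq_real,
    inner_add_left, real_inner_smul_left]
  linarith

/-- As `f` is bounded below by `f xs`, the quadratic term makes the objective coercive, and it is
continuous in finite dimension. -/
lemma exists_forall_auxObjective_le (hdiff : Differentiable ℝ f) (hH : 0 < H)
    {xs : EuclideanSpace ℝ (Fin n)} (hxs : ∀ x, f xs ≤ f x) (c : EuclideanSpace ℝ (Fin n)) :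
    ∃ m, ∀ y, auxObjective f H c m ≤ auxObjective f H c y := by
  refine (differentiable_auxObjective hdiff c).continuous.exists_forall_le ?_
  refine Filter.tendsto_atTop_mono (f := fun y => f xs + H / 2 * ‖y - c‖ ^ 2) (fun y => ?_) ?_
  · rw [auxObjective]; linarith [hxs y]
  · refine Filter.tendsto_atTop_add_const_left _ _
      (Filter.Tendsto.const_mul_atTop (by positivity) ?_)
    refine (Filter.tendsto_pow_atTop two_ne_zero).comp ?_
    simpa [dist_eq_norm] using tendsto_dist_right_cocompact_atTop c

lemma gradient_eq_zero_of_forall_le {F : EuclideanSpace ℝ (Fin n) → ℝ} (h : ∀ y, F m ≤ F y) :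
    gradient F m = 0 := by
  have : IsLocalMin F m := Filter.Eventually.of_forall h
  simp [gradient, this.fderiv_eq_zero]

lemma norm_gradient_auxObjective_sub_le (hdiff : Differentiable ℝ f) (hH : 0 < H)
    (hL : ∀ x y, ‖gradient f x - gradient f y‖ ≤ L * ‖x - y‖)
    (c x y : EuclideanSpace ℝ (Fin n)) :
    ‖gradient (auxObjective f H c) x - gradient (auxObjective f H c) y‖ ≤ (L + H) * ‖x - y‖ := by
  rw [gradient_auxObjective hdiff, gradient_auxObjective hdiff]
  calc _ = ‖(gradient f x - gradient f y) + H • (x - y)‖ := by congr 1; module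
    _ ≤ ‖gradient f x - gradient f y‖ + ‖H • (x - y)‖ := norm_add_le _ _
    _ ≤ _ := by
      rw [norm_smul, Real.norm_of_nonneg hH.le]
      linarith [hL x y]

/-- The Polyak–Łojasiewicz inequality for the auxiliary objective. -/
lemma auxObjective_sub_le_norm_gradient_sq (hdiff : Differentiable ℝ f)
    (hconv : ConvexOn ℝ Set.univ f) (hH : 0 < H) (c x y : EuclideanSpace ℝ (Fin n)) :
    2 * H * (auxObjective f H c x - auxObjective f H c y)
      ≤ ‖gradient (auxObjective f H c) x‖ ^ 2 := by
  have h := auxObjective_strong_convex (H := H) hdiff hconv c x y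
  set g := gradient (auxObjective f H c) x
  -- Completing the square minimizes the strong-convexity lower bound over `y`.
  have h2 : 0 ≤ ‖g + H • (y - x)‖ ^ 2 := by positivity
  rw [norm_add_sq_real, norm_smul, real_inner_smul_right, Real.norm_of_nonneg hH.le] at h2
  nlinarith

/-- A sufficiently small relative residual makes the gradient of the auxiliary objective at most
`H` times the length of the step away from the prox-centre. -/
lemma norm_gradient_auxObjective_le_of_residual (hdiff : Differentiable ℝ f)
    (hconv : ConvexOn ℝ Set.univ f) (hH : 0 < H) (hL0 : 0 ≤ L)
    (hL : ∀ x y, ‖gradient f x - gradient f y‖ ≤ L * ‖x - y‖)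
    (hm : ∀ y, auxObjective f H c m ≤ auxObjective f H c y) {v : EuclideanSpace ℝ (Fin n)}
    (hv : (auxObjective f H c v - auxObjective f H c m) * ((1 + L / H) * (3 + 2 * L / H) ^ 2)
      ≤ auxObjective f H c c - auxObjective f H c m) :
    ‖gradient (auxObjective f H c) v‖ ≤ H * ‖v - c‖ := by
  have hgm := gradient_eq_zero_of_forall_le hm
  have h1 := auxObjective_strong_convex (H := H) hdiff hconv c m v
  have h2 := le_of_inner_gradient_sub_le (differentiable_auxObjective (H := H) hdiff c) m (c - m)
    ((L + H) * ‖c - m‖ ^ 2) (fun t ht => by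
      refine (real_inner_le_norm _ _).trans ?_
      have := norm_gradient_auxObjective_sub_le hdiff hH hL c (m + t • (c - m)) m
      rw [add_sub_cancel_left, norm_smul, Real.norm_of_nonneg ht.le] at this
      calc _ ≤ (L + H) * (t * ‖c - m‖) * ‖c - m‖ := by gcongr
        _ = _ := by ring)
  rw [hgm, inner_zero_left, add_zero, add_sub_cancel] at h2
  rw [hgm, inner_zero_left, add_zero] at h1
  set κ := 1 + L / H with hκ
  have hκ1 : 1 ≤ κ := by rw [hκ]; have : 0 ≤ L / H := by positivity
                         linarith
  have hLH : L + H = H * κ := by rw [hκ]; field_simp; ring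
  have hq : 3 + 2 * L / H = 1 + 2 * κ := by rw [hκ]; ring
  rw [hq] at hv
  -- Strong convexity bounds the residual of `v` below by `H/2 * ‖v - m‖²`; smoothness bounds that
  -- of `c` above by `H * κ / 2 * ‖c - m‖²`. With the triangle inequality this yields `2κ‖v - m‖ ≤
  -- ‖v - c‖`, twice what is needed.
  have h3 : ‖v - m‖ * (1 + 2 * κ) ≤ ‖c - m‖ := by
    refine le_of_sq_le_sq ?_ (norm_nonneg _)
    rw [hLH] at h2
    have h4 : H / 2 * ‖v - m‖ ^ 2 * (κ * (1 + 2 * κ) ^ 2) ≤ H * κ * ‖c - m‖ ^ 2 / 2 := by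
      refine le_trans ?_ (hv.trans ?_)
      · gcongr; linarith
      · linarith
    have h5 : 0 < H * κ / 2 := by positivity
    refine le_of_mul_le_mul_left ?_ h5
    linarith
  have h6 : ‖c - m‖ ≤ ‖v - c‖ + ‖v - m‖ := by
    calc _ = ‖(v - m) - (v - c)‖ := by congr 1; abel
      _ ≤ _ := by rw [add_comm]; exact norm_sub_le _ _
  have h7 := norm_gradient_auxObjective_sub_le hdiff hH hL c v m
  rw [hgm, sub_zero, hLH] at h7
  refine h7.trans ?_
  rw [mul_assoc]
  gcongr
  nlinarith [norm_nonneg (v - m)]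

/-- One coordinate descent step decreases the auxiliary objective by the squared partial derivative
divided by twice the coordinate smoothness constant. -/
lemma auxObjective_coordStep_le (hdiff : Differentiable ℝ f) (hH : 0 < H) {Lc : Fin n → ℝ}
    (hLc0 : ∀ i, 0 ≤ Lc i)
    (hLc : ∀ (i : Fin n) (x : EuclideanSpace ℝ (Fin n)) (u : ℝ),
      |gradient f (x + EuclideanSpace.single i u) i - gradient f x i| ≤ Lc i * |u|)
    (c y : EuclideanSpace ℝ (Fin n)) (i : Fin n) :
    auxObjective f H c (coordStep (auxObjective f H c) (fun i => H + Lc i) y i)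
      ≤ auxObjective f H c y - (gradient (auxObjective f H c) y i) ^ 2 / (2 * (H + Lc i)) := by
  have hβ : 0 < H + Lc i := by linarith [hLc0 i]
  set g := gradient (auxObjective f H c) y i with hg
  set u := -(1 / (H + Lc i) * g) with hu
  have hstep : coordStep (auxObjective f H c) (fun i => H + Lc i) y i
      = y + EuclideanSpace.single i u := by
    rw [coordStep, hu, ← hg, sub_eq_add_neg]
    congr 1
    ext j
    by_cases h : j = i <;> simp [h]
  have hin (w : EuclideanSpace ℝ (Fin n)) : ⟪w, EuclideanSpace.single i u⟫ = w i * u := by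
    simp [EuclideanSpace.inner_single_right, mul_comm]
  -- Only smoothness along `e_i` enters, so the constant is `H + Lc i` rather than `H + L`.
  have h2 := le_of_inner_gradient_sub_le (differentiable_auxObjective (H := H) hdiff c) y
    (EuclideanSpace.single i u) ((H + Lc i) * u ^ 2) (fun t ht => by
      have hs : t • EuclideanSpace.single i u = EuclideanSpace.single i (t * u) := by
        ext j
        by_cases h : j = i <;> simp [h]
      rw [hin, hs, gradient_auxObjective hdiff, gradient_auxObjective hdiff]
      have h3 := hLc i y (t * u)
      have h4 : (gradient f (y + EuclideanSpace.single i (t * u)) i - gradient f y i) * u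
          ≤ Lc i * |t * u| * |u| :=
        (le_abs_self _).trans (by rw [abs_mul]; gcongr)
      rw [abs_mul, abs_of_pos ht, mul_assoc, mul_assoc, abs_mul_abs_self] at h4
      simp
      linarith)
  rw [hin, ← hg] at h2
  rw [hstep]
  refine h2.trans (le_of_eq ?_)
  rw [hu]
  field_simp
  ring

end AuxObjective

/-! ### Functions of finitely many independent draws -/

section Independence

open MeasureTheory ProbabilityTheory

variable {ι : Type*} {n : ℕ} {Ω : Type*} [MeasurableSpace Ω] {P : Measure Ω}
  [IsProbabilityMeasure P] {s : ι → Ω → Fin n}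

/-- A function of finitely many draws factors through the finite type `T → Fin n`, so measurability
and integrability are automatic. -/
lemma DependsOn.integrable_comp (hs : ∀ q, Measurable (s q))
    {T : Finset ι} {h : (ι → Fin n) → ℝ} (hT : DependsOn h (T : Set ι)) :
    Integrable (fun ω => h (fun q => s q ω)) P := by
  obtain ⟨g, hg⟩ := dependsOn_iff_exists_comp.1 hT
  have hm : Measurable (fun ω (q : T) => s q ω) := measurable_pi_lambda _ fun q => hs q
  have := (Integrable.of_finite (μ := P.map (fun ω (q : T) => s q ω)) (f := g)).comp_measurable hm
  rw [hg]
  exact this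

/-- Integrating out one coordinate of an independent family. -/
lemma iIndepFun.integral_eq_sum (hs : ∀ q, Measurable (s q)) (hind : iIndepFun s P)
    {T : Finset ι} {q : ι} (hq : q ∉ T) {h : Fin n → (ι → Fin n) → ℝ}
    (hT : ∀ i, DependsOn (h i) (T : Set ι)) :
    ∫ ω, h (s q ω) (fun q => s q ω) ∂P
      = ∑ i, P.real {ω | s q ω = i} * ∫ ω, h i (fun q => s q ω) ∂P := by
  classical
  have hmT : Measurable (fun ω (q : T) => s q ω) := measurable_pi_lambda _ fun q => hs q
  have hmq' : Measurable (fun ω (q' : ({q} : Finset ι)) => s q' ω) :=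
    measurable_pi_lambda _ fun q => hs q
  have hmq (i : Fin n) : MeasurableSet {ω | s q ω = i} := hs q (measurableSet_singleton i)
  have hsplit (ω : Ω) : h (s q ω) (fun q => s q ω)
      = ∑ i, {ω | s q ω = i}.indicator (1 : Ω → ℝ) ω * h i (fun q => s q ω) := by
    simp [Set.indicator_apply]
  have hindep := hind.indepFun_finset {q} T (by simpa using hq) hs
  have hfac (i : Fin n) : ∫ ω, {ω | s q ω = i}.indicator (1 : Ω → ℝ) ω * h i (fun q => s q ω) ∂P
      = P.real {ω | s q ω = i} * ∫ ω, h i (fun q => s q ω) ∂P := by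
    obtain ⟨g, hg⟩ := dependsOn_iff_exists_comp.1 (hT i)
    have hc := hindep.comp
      (φ := fun z : (({q} : Finset ι) → Fin n) => if z ⟨q, by simp⟩ = i then (1 : ℝ) else 0)
      (ψ := g) (measurable_of_finite _) (measurable_of_finite _)
    have := hc.integral_fun_mul_eq_mul_integral
      ((measurable_of_finite _).comp hmq').aestronglyMeasurable
      ((measurable_of_finite _).comp hmT).aestronglyMeasurable
    have hindicator : {ω | s q ω = i}.indicator (1 : Ω → ℝ)
        = fun ω => if s q ω = i then (1 : ℝ) else 0 := by
      ext ω
      simp [Set.indicator_apply]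
    rw [← integral_indicator_one (hmq i), hg, hindicator]
    exact this
  simp_rw [hsplit]
  rw [integral_finsetSum]
  · exact Finset.sum_congr rfl fun i _ => hfac i
  · intro i _
    have := ((hT i).integrable_comp (P := P) hs).indicator (hmq i)
    refine this.congr (Filter.Eventually.of_forall fun ω => ?_)
    by_cases hω : s q ω = i <;> simp [hω]

end Independence

/-! ### Potential and rate of the outer loop -/

section MetaAlgorithm

open scoped RealInnerProductSpace

variable {n : ℕ} {f : EuclideanSpace ℝ (Fin n) → ℝ} {H lam A : ℝ}

lemma metaWeight_pos (hlam : 0 < lam) : 0 < metaWeight lam A := by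
  rw [metaWeight]
  positivity

lemma metaWeight_sq (hlam : 0 < lam) (hA : 0 ≤ A) :
    metaWeight lam A ^ 2 = lam * (A + metaWeight lam A) := by
  have h : √(lam ^ 2 + 4 * lam * A) ^ 2 = lam ^ 2 + 4 * lam * A := Real.sq_sqrt (by positivity)
  rw [metaWeight]
  linear_combination h / 4

/-- The weight is at least `lam / 2 + √(lam * A)`, which exceeds the increment in `(√A + √lam /
2)²`. Summing gives quadratic growth of `A_k`. -/
lemma sqrt_add_le_sqrt_add_metaWeight (hlam : 0 < lam) (hA : 0 ≤ A) :
    √A + √lam / 2 ≤ √(A + metaWeight lam A) := by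
  apply Real.le_sqrt_of_sq_le
  have h1 : √A ^ 2 = A := Real.sq_sqrt hA
  have h2 : √lam ^ 2 = lam := Real.sq_sqrt hlam.le
  have h3 : 2 * (√lam * √A) ≤ √(lam ^ 2 + 4 * lam * A) := by
    apply Real.le_sqrt_of_sq_le
    calc (2 * (√lam * √A)) ^ 2 = 4 * (√lam ^ 2) * √A ^ 2 := by ring
      _ ≤ _ := by rw [h1, h2]; nlinarith
  rw [metaWeight]
  nlinarith

/-- One step of the meta-algorithm does not increase the potential, provided that the auxiliary
problem is solved accurately enough. -/
lemma metaStep_potential_le (hdiff : Differentiable ℝ f) (hconv : ConvexOn ℝ Set.univ f)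
    (hH : 0 < H) (xs : EuclideanSpace ℝ (Fin n))
    (inner' : EuclideanSpace ℝ (Fin n) → EuclideanSpace ℝ (Fin n)) (S : MetaState n)
    (hA : 0 ≤ S.A)
    (hinner : ‖gradient (auxObjective f H (metaCentre (1 / (2 * H)) S))
        (inner' (metaCentre (1 / (2 * H)) S))‖
      ≤ H * ‖inner' (metaCentre (1 / (2 * H)) S) - metaCentre (1 / (2 * H)) S‖) :
    (metaStep f H inner' S).A * (f (metaStep f H inner' S).v - f xs)
        + ‖(metaStep f H inner' S).x - xs‖ ^ 2 / 2
      ≤ S.A * (f S.v - f xs) + ‖S.x - xs‖ ^ 2 / 2 := by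
  have hlam : 0 < 1 / (2 * H) := by positivity
  simp only [metaStep]
  set c := metaCentre (1 / (2 * H)) S with hc
  set v := inner' c
  have ha := metaWeight_pos (A := S.A) hlam
  have hsq := metaWeight_sq hlam hA
  rw [metaCentre] at hc
  set a := metaWeight (1 / (2 * H)) S.A
  have hA' : 0 < S.A + a := by linarith
  have hcA : (S.A + a) • c = S.A • S.v + a • S.x := by
    rw [hc, smul_inv_smul₀ hA'.ne']
  rw [gradient_auxObjective hdiff] at hinner
  set g := gradient f v
  have h1 := hconv.add_inner_gradient_le hdiff v S.v
  have h2 := hconv.add_inner_gradient_le hdiff v xs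
  -- Squaring the criterion cancels `H²‖v - c‖²`.
  have hcore : ⟪g, v - c⟫ + 1 / (2 * H) * ‖g‖ ^ 2 ≤ 0 := by
    have h3 : ‖g + H • (v - c)‖ ^ 2 ≤ (H * ‖v - c‖) ^ 2 := by gcongr
    rw [norm_add_sq_real, norm_smul, real_inner_smul_right, Real.norm_of_nonneg hH.le] at h3
    have h4 : 2 * H * (⟪g, v - c⟫ + 1 / (2 * H) * ‖g‖ ^ 2) ≤ 0 := by
      field_simp
      linarith
    nlinarith
  have h5 : ‖S.x - a • g - xs‖ ^ 2
      = ‖S.x - xs‖ ^ 2 - 2 * a * ⟪g, S.x - xs⟫ + a ^ 2 * ‖g‖ ^ 2 := by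
    rw [sub_right_comm, norm_sub_sq_real, norm_smul, real_inner_smul_right, real_inner_comm,
      mul_pow, Real.norm_of_nonneg ha.le]
    ring
  -- The choice of `c` eliminates `S.x`, leaving exactly the terms controlled by convexity at `S.v`
  -- and `xs`.
  have h6 : (S.A + a) * ⟪g, v - c⟫ + a * ⟪g, S.x - xs⟫
      = - (S.A * ⟪g, S.v - v⟫) - a * ⟪g, xs - v⟫ := by
    have : (S.A + a) * ⟪g, c⟫ = S.A * ⟪g, S.v⟫ + a * ⟪g, S.x⟫ := by
      rw [← real_inner_smul_right, hcA, inner_add_right, real_inner_smul_right,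
        real_inner_smul_right]
    simp only [inner_sub_right]
    linear_combination -this
  have h7 : 0 ≤ 1 / (2 * H) * ‖g‖ ^ 2 := by positivity
  -- Since `a² = (S.A + a) / (2H)`, only half of the `‖g‖²` term in `hcore` is needed.
  have h8 : (S.A + a) * (⟪g, v - c⟫ + 1 / (2 * H) * ‖g‖ ^ 2 / 2) ≤ 0 :=
    mul_nonpos_of_nonneg_of_nonpos hA'.le (by linarith)
  rw [h5, hsq]
  nlinarith [mul_le_mul_of_nonneg_left h1 hA, mul_le_mul_of_nonneg_left h2 ha.le]

variable {Lc : Fin n → ℝ} {x₀ : EuclideanSpace ℝ (Fin n)} {N : ℕ} {s : ℕ → ℕ → Fin n}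

lemma metaRun_weight (hH : 0 < H) (K : ℕ) :
    0 ≤ (metaRun f H Lc x₀ N s K).A ∧
      K * (√(1 / (2 * H)) / 2) ≤ √(metaRun f H Lc x₀ N s K).A := by
  induction K with
  | zero => simp [metaRun]
  | succ K ih =>
    have hlam : 0 < 1 / (2 * H) := by positivity
    have h1 := sqrt_add_le_sqrt_add_metaWeight hlam ih.1
    have h2 := metaWeight_pos (A := (metaRun f H Lc x₀ N s K).A) hlam
    simp only [metaRun, metaStep]
    refine ⟨by linarith [ih.1], ?_⟩
    push_cast
    linarith [ih.2]

lemma metaRun_potential_le (hdiff : Differentiable ℝ f) (hconv : ConvexOn ℝ Set.univ f)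
    (hH : 0 < H) (xs : EuclideanSpace ℝ (Fin n)) (K : ℕ)
    (hinner : ∀ k < K, ‖gradient (auxObjective f H (metaCentre (1 / (2 * H))
        (metaRun f H Lc x₀ N s k))) (metaRun f H Lc x₀ N s (k + 1)).v‖
      ≤ H * ‖(metaRun f H Lc x₀ N s (k + 1)).v
        - metaCentre (1 / (2 * H)) (metaRun f H Lc x₀ N s k)‖) :
    (metaRun f H Lc x₀ N s K).A * (f (metaRun f H Lc x₀ N s K).v - f xs)
        + ‖(metaRun f H Lc x₀ N s K).x - xs‖ ^ 2 / 2 ≤ ‖x₀ - xs‖ ^ 2 / 2 := by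
  induction K with
  | zero => simp [metaRun]
  | succ K ih =>
    refine le_trans ?_ (ih fun k hk => hinner k (by omega))
    exact metaStep_potential_le hdiff hconv hH xs _ _ (metaRun_weight hH K).1
      (hinner K (by omega))

/-- The convergence rate of the meta-algorithm. -/
lemma metaRun_sub_lt (hdiff : Differentiable ℝ f) (hconv : ConvexOn ℝ Set.univ f)
    (hH : 0 < H) (xs : EuclideanSpace ℝ (Fin n)) {ε : ℝ} (hε : 0 < ε) (K : ℕ)
    (hK : 4 * √15 / 5 * √(H * ‖x₀ - xs‖ ^ 2 / ε) ≤ K)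
    (hinner : ∀ k < K, ‖gradient (auxObjective f H (metaCentre (1 / (2 * H))
        (metaRun f H Lc x₀ N s k))) (metaRun f H Lc x₀ N s (k + 1)).v‖
      ≤ H * ‖(metaRun f H Lc x₀ N s (k + 1)).v
        - metaCentre (1 / (2 * H)) (metaRun f H Lc x₀ N s k)‖) :
    f (metaRun f H Lc x₀ N s K).v - f xs < ε := by
  have hpot := metaRun_potential_le hdiff hconv hH xs K hinner
  obtain ⟨hA0, hA⟩ := metaRun_weight (f := f) (Lc := Lc) (x₀ := x₀) (N := N) (s := s) hH K
  set S := metaRun f H Lc x₀ N s K with hS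
  have hK2 : 48 / 5 * (H * ‖x₀ - xs‖ ^ 2) ≤ K ^ 2 * ε := by
    have h1 : (4 * √15 / 5 * √(H * ‖x₀ - xs‖ ^ 2 / ε)) ^ 2 ≤ (K : ℝ) ^ 2 := by gcongr
    rw [mul_pow, Real.sq_sqrt (by positivity), div_pow, mul_pow,
      Real.sq_sqrt (by norm_num)] at h1
    rw [← div_le_iff₀ hε]
    calc _ = _ := by ring
      _ ≤ _ := h1
  -- With `K = 0` the bound on `K` forces `x₀ = xs`.
  rcases Nat.eq_zero_or_pos K with rfl | hKpos
  · have h0 : ‖x₀ - xs‖ ^ 2 ≤ 0 := by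
      norm_num at hK2
      nlinarith [sq_nonneg ‖x₀ - xs‖]
    have h1 : x₀ - xs = 0 := by
      simpa using le_antisymm h0 (by positivity)
    simp only [hS, metaRun]
    rw [sub_eq_zero.1 h1, sub_self]
    exact hε
  · have hA2 : (K : ℝ) ^ 2 ≤ 8 * H * S.A := by
      have h1 : (K * (√(1 / (2 * H)) / 2)) ^ 2 ≤ √S.A ^ 2 := by gcongr
      rw [Real.sq_sqrt hA0, mul_pow, div_pow, Real.sq_sqrt (by positivity)] at h1
      calc (K : ℝ) ^ 2 = 8 * H * (K ^ 2 * (1 / (2 * H) / 2 ^ 2)) := by field_simp; norm_num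
        _ ≤ _ := by gcongr
    have hK0 : (0 : ℝ) < K ^ 2 := by positivity
    by_contra! hcon
    have h3 : S.A * ε ≤ S.A * (f S.v - f xs) := by gcongr
    have h4 : S.A * ε ≤ ‖x₀ - xs‖ ^ 2 / 2 := by linarith [sq_nonneg ‖S.x - xs‖]
    have h5 : (K : ℝ) ^ 2 * ε ≤ 4 * (H * ‖x₀ - xs‖ ^ 2) := by
      calc (K : ℝ) ^ 2 * ε ≤ 8 * H * S.A * ε := by gcongr
        _ = 8 * H * (S.A * ε) := by ring
        _ ≤ 8 * H * (‖x₀ - xs‖ ^ 2 / 2) := by gcongr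
        _ = _ := by ring
    have h6 : 0 < (K : ℝ) ^ 2 * ε := by positivity
    linarith

end MetaAlgorithm

/-! ### One-step contraction and dependence on the draws -/

section CoordinateDescent

variable {n : ℕ} {f : EuclideanSpace ℝ (Fin n) → ℝ} {H : ℝ} {Lc : Fin n → ℝ}

/-- One random coordinate descent step contracts the residual in expectation. -/
lemma sum_auxObjective_coordStep_le [Nonempty (Fin n)] (hdiff : Differentiable ℝ f)
    (hconv : ConvexOn ℝ Set.univ f) (hH : 0 < H) (hLc0 : ∀ i, 0 ≤ Lc i)
    (hLc : ∀ (i : Fin n) (x : EuclideanSpace ℝ (Fin n)) (u : ℝ),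
      |gradient f (x + EuclideanSpace.single i u) i - gradient f x i| ≤ Lc i * |u|)
    {Z : ℝ} (hZ : Z = ∑ i, (H + Lc i)) (c y m : EuclideanSpace ℝ (Fin n)) :
    ∑ i, (H + Lc i) / Z *
        (auxObjective f H c (coordStep (auxObjective f H c) (fun i => H + Lc i) y i)
          - auxObjective f H c m)
      ≤ (1 - H / Z) * (auxObjective f H c y - auxObjective f H c m) := by
  have hβ (i : Fin n) : 0 < H + Lc i := by linarith [hLc0 i]
  have hZ0 : 0 < Z := by
    rw [hZ]
    exact Finset.sum_pos (fun i _ => hβ i) Finset.univ_nonempty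
  have hPL := auxObjective_sub_le_norm_gradient_sq hdiff hconv hH c y m
  set D := auxObjective f H c y - auxObjective f H c m with hD
  set g := gradient (auxObjective f H c) y with hg
  have hnorm : ‖g‖ ^ 2 = ∑ i, g i ^ 2 := by
    simp [EuclideanSpace.norm_sq_eq]
  have hterm (i : Fin n) : (H + Lc i) / Z *
        (auxObjective f H c (coordStep (auxObjective f H c) (fun i => H + Lc i) y i)
          - auxObjective f H c m) ≤ (H + Lc i) * (D / Z) - g i ^ 2 * (1 / (2 * Z)) := by
    have h1 := auxObjective_coordStep_le hdiff hH hLc0 hLc c y i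
    have h2 := (hβ i).ne'
    calc _ ≤ (H + Lc i) / Z * (D - g i ^ 2 / (2 * (H + Lc i))) := by
          refine mul_le_mul_of_nonneg_left ?_ (div_pos (hβ i) hZ0).le
          rw [← hg] at h1
          linarith
      _ = _ := by field_simp
  calc _ ≤ ∑ i, ((H + Lc i) * (D / Z) - g i ^ 2 * (1 / (2 * Z))) :=
        Finset.sum_le_sum fun i _ => hterm i
    _ = D - ‖g‖ ^ 2 * (1 / (2 * Z)) := by
        rw [Finset.sum_sub_distrib, ← Finset.sum_mul, ← Finset.sum_mul, ← hZ, ← hnorm]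
        field_simp
    _ ≤ D - 2 * H * D * (1 / (2 * Z)) := by gcongr
    _ = _ := by field_simp

/-- Descent holds for every sequence of draws. Hence a centre that already solves its auxiliary
problem cannot cause a failure. -/
lemma auxObjective_coordDescent_le (hdiff : Differentiable ℝ f) (hH : 0 < H)
    (hLc0 : ∀ i, 0 ≤ Lc i)
    (hLc : ∀ (i : Fin n) (x : EuclideanSpace ℝ (Fin n)) (u : ℝ),
      |gradient f (x + EuclideanSpace.single i u) i - gradient f x i| ≤ Lc i * |u|)
    (c y₀ : EuclideanSpace ℝ (Fin n)) (s : ℕ → Fin n) (N : ℕ) :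
    auxObjective f H c (coordDescent (auxObjective f H c) (fun i => H + Lc i) y₀ s N)
      ≤ auxObjective f H c y₀ := by
  induction N with
  | zero => exact le_rfl
  | succ N ih =>
    refine (auxObjective_coordStep_le hdiff hH hLc0 hLc c _ (s N)).trans ?_
    have : 0 < H + Lc (s N) := by linarith [hLc0 (s N)]
    refine le_trans (sub_le_self _ (by positivity)) ih

lemma coordDescent_congr (F : EuclideanSpace ℝ (Fin n) → ℝ) (β : Fin n → ℝ)
    (y₀ : EuclideanSpace ℝ (Fin n)) {s s' : ℕ → Fin n} {N : ℕ} (h : ∀ j < N, s j = s' j) :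
    coordDescent F β y₀ s N = coordDescent F β y₀ s' N := by
  induction N with
  | zero => rfl
  | succ N ih => rw [coordDescent, coordDescent, ih fun j hj => h j (by omega), h N (by omega)]

lemma metaRun_congr (x₀ : EuclideanSpace ℝ (Fin n)) {N : ℕ} {s s' : ℕ → ℕ → Fin n} {K : ℕ}
    (h : ∀ k < K, ∀ j < N, s k j = s' k j) :
    metaRun f H Lc x₀ N s K = metaRun f H Lc x₀ N s' K := by
  induction K with
  | zero => rfl
  | succ K ih =>
    rw [metaRun, metaRun, ih fun k hk => h k (by omega)]
    congr 1
    ext1 c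
    exact coordDescent_congr _ _ _ (h K (by omega))

end CoordinateDescent

/-! ### Failure probability of one outer iteration -/

section Probability

open MeasureTheory ProbabilityTheory

variable {n : ℕ} {f : EuclideanSpace ℝ (Fin n) → ℝ} {H : ℝ} {Lc : Fin n → ℝ}

/-- The residual of `y` for the auxiliary problem with prox-centre `c`, relative to that of `c`;
`m c` is the solution of this problem. -/
noncomputable def relResidual (f : EuclideanSpace ℝ (Fin n) → ℝ) (H : ℝ)
    (m : EuclideanSpace ℝ (Fin n) → EuclideanSpace ℝ (Fin n))
    (c y : EuclideanSpace ℝ (Fin n)) : ℝ :=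
  (auxObjective f H c y - auxObjective f H c (m c))
    / (auxObjective f H c c - auxObjective f H c (m c))

/-- The prox-centre of the outer iteration `k`. -/
noncomputable def runCentre (f : EuclideanSpace ℝ (Fin n) → ℝ) (H : ℝ) (Lc : Fin n → ℝ)
    (x₀ : EuclideanSpace ℝ (Fin n)) (N : ℕ) (k : ℕ) (w : ℕ × ℕ → Fin n) :
    EuclideanSpace ℝ (Fin n) :=
  metaCentre (1 / (2 * H)) (metaRun f H Lc x₀ N (fun k j => w (k, j)) k)

/-- The iterate of coordinate descent after `j` steps of the outer iteration `k`. -/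
noncomputable def runInner (f : EuclideanSpace ℝ (Fin n) → ℝ) (H : ℝ) (Lc : Fin n → ℝ)
    (x₀ : EuclideanSpace ℝ (Fin n)) (N : ℕ) (k j : ℕ) (w : ℕ × ℕ → Fin n) :
    EuclideanSpace ℝ (Fin n) :=
  coordDescent (auxObjective f H (runCentre f H Lc x₀ N k w)) (fun i => H + Lc i)
    (runCentre f H Lc x₀ N k w) (fun j => w (k, j)) j

/-- The draws made before the inner step `j` of the outer iteration `k`. -/
noncomputable def drawsBefore (N k j : ℕ) : Finset (ℕ × ℕ) :=
  Finset.range k ×ˢ Finset.range N ∪ {k} ×ˢ Finset.range j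

/-- The current row of draws is not used; the larger set is taken so that centre and inner iterate
share one set excluding `(k, j)`. -/
lemma dependsOn_runCentre (x₀ : EuclideanSpace ℝ (Fin n)) (N k j : ℕ) :
    DependsOn (runCentre f H Lc x₀ N k) (drawsBefore N k j : Set (ℕ × ℕ)) := by
  intro w w' h
  rw [runCentre, runCentre, metaRun_congr x₀ fun k' hk' j' hj' => h (k', j') ?_]
  simp [drawsBefore, hk', hj']

lemma dependsOn_runInner (x₀ : EuclideanSpace ℝ (Fin n)) (N k j : ℕ) :
    DependsOn (runInner f H Lc x₀ N k j) (drawsBefore N k j : Set (ℕ × ℕ)) := by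
  intro w w' h
  rw [runInner, runInner, dependsOn_runCentre x₀ N k j h]
  refine coordDescent_congr _ _ _ fun j' hj' => h (k, j') ?_
  simp [drawsBefore, hj']

variable {Ω : Type*} [MeasurableSpace Ω] {P : Measure Ω} [IsProbabilityMeasure P]
  {s : ℕ × ℕ → Ω → Fin n} {Z : ℝ}

lemma integrable_relResidual_runInner (hs : ∀ q, Measurable (s q))
    (m : EuclideanSpace ℝ (Fin n) → EuclideanSpace ℝ (Fin n)) (x₀ : EuclideanSpace ℝ (Fin n))
    (N k j : ℕ) :
    Integrable (fun ω => relResidual f H m (runCentre f H Lc x₀ N k fun q => s q ω)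
      (runInner f H Lc x₀ N k j fun q => s q ω)) P := by
  refine DependsOn.integrable_comp (T := drawsBefore N k j)
    (h := fun w => relResidual f H m (runCentre f H Lc x₀ N k w) (runInner f H Lc x₀ N k j w))
    hs fun w w' h => ?_
  simp only [dependsOn_runCentre x₀ N k j h, dependsOn_runInner x₀ N k j h]

/-- Linear convergence in expectation of the inner method. -/
lemma integral_relResidual_runInner_le [Nonempty (Fin n)] (hdiff : Differentiable ℝ f)
    (hconv : ConvexOn ℝ Set.univ f) (hH : 0 < H) (hLc0 : ∀ i, 0 ≤ Lc i)
    (hLc : ∀ (i : Fin n) (x : EuclideanSpace ℝ (Fin n)) (u : ℝ),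
      |gradient f (x + EuclideanSpace.single i u) i - gradient f x i| ≤ Lc i * |u|)
    (hZ : Z = ∑ i, (H + Lc i)) (hHZ : H ≤ Z)
    {m : EuclideanSpace ℝ (Fin n) → EuclideanSpace ℝ (Fin n)}
    (hm : ∀ c y, auxObjective f H c (m c) ≤ auxObjective f H c y)
    (hs : ∀ q, Measurable (s q)) (hind : iIndepFun s P)
    (hlaw : ∀ q i, P.real {ω | s q ω = i} = (H + Lc i) / Z)
    (x₀ : EuclideanSpace ℝ (Fin n)) (N k j : ℕ) :
    ∫ ω, relResidual f H m (runCentre f H Lc x₀ N k fun q => s q ω)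
      (runInner f H Lc x₀ N k j fun q => s q ω) ∂P ≤ (1 - H / Z) ^ j := by
  have hHZ' : 0 ≤ 1 - H / Z := by
    rw [sub_nonneg]
    exact div_le_one_of_le₀ hHZ (hH.le.trans hHZ)
  induction j with
  | zero =>
    calc _ ≤ ∫ ω, (1 : ℝ) ∂P := by
          refine integral_mono (integrable_relResidual_runInner hs m x₀ N k 0)
            (integrable_const _) fun ω => ?_
          -- Only `≤ 1`: the quotient is `0 / 0 = 0` when the centre is already optimal.
          exact div_self_le_one _
      _ = _ := by simp
  | succ j ih =>
    set h : Fin n → (ℕ × ℕ → Fin n) → ℝ := fun i w =>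
      relResidual f H m (runCentre f H Lc x₀ N k w)
        (coordStep (auxObjective f H (runCentre f H Lc x₀ N k w)) (fun i => H + Lc i)
          (runInner f H Lc x₀ N k j w) i) with hh
    have hdep (i : Fin n) : DependsOn (h i) (drawsBefore N k j : Set (ℕ × ℕ)) := by
      intro w w' hw
      simp only [hh, dependsOn_runCentre x₀ N k j hw, dependsOn_runInner x₀ N k j hw]
    have hq : (k, j) ∉ drawsBefore N k j := by simp [drawsBefore]
    calc _ = ∫ ω, h (s (k, j) ω) (fun q => s q ω) ∂P := rfl
      _ = ∑ i, (H + Lc i) / Z * ∫ ω, h i (fun q => s q ω) ∂P := by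
          rw [iIndepFun.integral_eq_sum hs hind hq hdep]
          simp_rw [hlaw]
      _ = ∫ ω, ∑ i, (H + Lc i) / Z * h i (fun q => s q ω) ∂P := by
          rw [integral_finsetSum _ fun i _ => ((hdep i).integrable_comp hs).const_mul _]
          simp_rw [integral_const_mul]
      _ ≤ ∫ ω, (1 - H / Z) * relResidual f H m (runCentre f H Lc x₀ N k fun q => s q ω)
            (runInner f H Lc x₀ N k j fun q => s q ω) ∂P := by
          refine integral_mono
            (integrable_finsetSum _ fun i _ => ((hdep i).integrable_comp hs).const_mul _)
            ((integrable_relResidual_runInner hs m x₀ N k j).const_mul _) fun ω => ?_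
          simp only [hh, relResidual, ← mul_div_assoc, ← Finset.sum_div]
          exact div_le_div_of_nonneg_right
            (sum_auxObjective_coordStep_le hdiff hconv hH hLc0 hLc hZ _ _ _)
            (sub_nonneg.2 (hm _ _))
      _ ≤ _ := by
          rw [integral_const_mul, pow_succ']
          gcongr

/-- With high probability the inner method reduces the residual by the factor `C`. -/
lemma measureReal_residual_gt_le [Nonempty (Fin n)] (hdiff : Differentiable ℝ f)
    (hconv : ConvexOn ℝ Set.univ f) (hH : 0 < H) (hLc0 : ∀ i, 0 ≤ Lc i)
    (hLc : ∀ (i : Fin n) (x : EuclideanSpace ℝ (Fin n)) (u : ℝ),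
      |gradient f (x + EuclideanSpace.single i u) i - gradient f x i| ≤ Lc i * |u|)
    (hZ : Z = ∑ i, (H + Lc i)) (hHZ : H ≤ Z)
    {m : EuclideanSpace ℝ (Fin n) → EuclideanSpace ℝ (Fin n)}
    (hm : ∀ c y, auxObjective f H c (m c) ≤ auxObjective f H c y)
    (hs : ∀ q, Measurable (s q)) (hind : iIndepFun s P)
    (hlaw : ∀ q i, P.real {ω | s q ω = i} = (H + Lc i) / Z)
    (x₀ : EuclideanSpace ℝ (Fin n)) (N k : ℕ) {p C : ℝ} (hp : 0 < p) (hC : 0 < C)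
    (hN : Z / H * Real.log (p⁻¹ * C) ≤ N) :
    P.real {ω | auxObjective f H (runCentre f H Lc x₀ N k fun q => s q ω)
          (runCentre f H Lc x₀ N k fun q => s q ω)
        - auxObjective f H (runCentre f H Lc x₀ N k fun q => s q ω)
          (m (runCentre f H Lc x₀ N k fun q => s q ω))
      < (auxObjective f H (runCentre f H Lc x₀ N k fun q => s q ω)
          (runInner f H Lc x₀ N k N fun q => s q ω)
        - auxObjective f H (runCentre f H Lc x₀ N k fun q => s q ω)
          (m (runCentre f H Lc x₀ N k fun q => s q ω))) * C} ≤ p := by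
  have hZ0 : 0 < Z := hH.trans_le hHZ
  have hmarkov := mul_meas_ge_le_integral_of_nonneg (μ := P)
    (Filter.Eventually.of_forall fun ω => div_nonneg (sub_nonneg.2 (hm _ _))
      (sub_nonneg.2 (hm _ _)))
    (integrable_relResidual_runInner (f := f) (H := H) (Lc := Lc) hs m x₀ N k N) C⁻¹
  have hint := integral_relResidual_runInner_le hdiff hconv hH hLc0 hLc hZ hHZ hm hs hind hlaw
    x₀ N k N
  have hpow : (1 - H / Z) ^ N ≤ p * C⁻¹ := by
    have hHZ' : 0 ≤ 1 - H / Z := by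
      rw [sub_nonneg]
      exact div_le_one_of_le₀ hHZ hZ0.le
    have hlog : Real.log (p⁻¹ * C) ≤ N * (H / Z) := by
      calc Real.log (p⁻¹ * C) = Z / H * Real.log (p⁻¹ * C) * (H / Z) := by field_simp
        _ ≤ _ := by gcongr
    calc (1 - H / Z) ^ N ≤ Real.exp (-(H / Z)) ^ N := by
          gcongr
          exact Real.one_sub_le_exp_neg _
      _ = Real.exp (-(N * (H / Z))) := by rw [← Real.exp_nat_mul]; ring_nf
      _ ≤ Real.exp (-Real.log (p⁻¹ * C)) := by gcongr
      _ = p * C⁻¹ := by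
          rw [Real.exp_neg, Real.exp_log (by positivity), mul_inv, inv_inv]
  have hP := (hmarkov.trans hint).trans hpow
  rw [mul_comm p] at hP
  refine le_trans (measureReal_mono fun ω hω => ?_) (le_of_mul_le_mul_left hP (inv_pos.2 hC))
  rw [Set.mem_ofPred_eq] at hω ⊢
  set c := runCentre f H Lc x₀ N k fun q => s q ω
  have hmono : auxObjective f H c (runInner f H Lc x₀ N k N fun q => s q ω)
      ≤ auxObjective f H c c :=
    auxObjective_coordDescent_le hdiff hH hLc0 hLc c c _ N
  -- If the centre were optimal, monotonicity would make the final residual nonpositive, against the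
  -- strict inequality in `hω`.
  have hD : 0 < auxObjective f H c c - auxObjective f H c (m c) := by
    by_contra! hcon
    have h1 := hm c c
    have h2 : (auxObjective f H c (runInner f H Lc x₀ N k N fun q => s q ω)
        - auxObjective f H c (m c)) * C ≤ 0 :=
      mul_nonpos_of_nonpos_of_nonneg (by linarith) hC.le
    linarith
  rw [le_div_iff₀ hD, inv_mul_le_iff₀ hC]
  linarith

end Probability
-- Union bound over the outer iterations
theorem theorem3 {n : ℕ} (f : EuclideanSpace ℝ (Fin n) → ℝ)
    (hdiff : Differentiable ℝ f) (hconv : ConvexOn ℝ Set.univ f)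
    (Lc : Fin n → ℝ)
    (hLc : ∀ (i : Fin n) (x : EuclideanSpace ℝ (Fin n)) (u : ℝ),
      |gradient f (x + EuclideanSpace.single i u) i - gradient f x i| ≤ Lc i * |u|)
    (L : ℝ)
    (hL : ∀ x y : EuclideanSpace ℝ (Fin n), ‖gradient f x - gradient f y‖ ≤ L * ‖x - y‖)
    (x₀ xs : EuclideanSpace ℝ (Fin n)) (hxs : ∀ x, f xs ≤ f x)
    (H ε δ : ℝ) (hH : 0 < H) (hε : 0 < ε) (hδ₀ : 0 < δ) (hδ₁ : δ < 1)
    (Z : ℝ) (hZ : Z = ∑ i, (H + Lc i))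
    {Ω : Type*} [MeasurableSpace Ω] (P : MeasureTheory.Measure Ω)
    [MeasureTheory.IsProbabilityMeasure P]
    (s : ℕ → ℕ → Ω → Fin n) (hs_meas : ∀ k j, Measurable (s k j))
    (hs_indep : ProbabilityTheory.iIndepFun (fun q : ℕ × ℕ => s q.1 q.2) P)
    (hs_law : ∀ k j i, P.real {ω | s k j ω = i} = (H + Lc i) / Z)
    (Nout Nin : ℕ)
    (hNout : ⌈4 * √15 / 5 * √(H * ‖x₀ - xs‖ ^ 2 / ε)⌉ ≤ (Nout : ℤ))
    (hNin : ⌈Z / H * Real.log ((Nout : ℝ) / δ * (1 + L / H) * (3 + 2 * L / H) ^ 2)⌉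
      ≤ (Nin : ℤ)) :
    1 - δ ≤ P.real {ω | f (metaRun f H Lc x₀ Nin (fun k j => s k j ω) Nout).v - f xs < ε} := by

  obtain ⟨ω₀⟩ : Nonempty Ω := P.nonempty_of_neZero
  -- The existence of a draw supplies `n ≥ 1`.
  have i₀ : Fin n := s 0 0 ω₀
  have : Nonempty (Fin n) := ⟨i₀⟩
  have hLc0 (i : Fin n) : 0 ≤ Lc i := by
    simpa using (abs_nonneg _).trans (hLc i 0 1)
  have hL0 : 0 ≤ L := by
    simpa using (norm_nonneg _).trans (hL (EuclideanSpace.single i₀ 1) 0)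
  have hHZ : H ≤ Z := by
    rw [hZ]
    refine le_trans (by linarith [hLc0 i₀])
      (Finset.single_le_sum (f := fun i => H + Lc i) (fun i _ => ?_) (Finset.mem_univ i₀))
    linarith [hLc0 i]
  choose m hm using exists_forall_auxObjective_le (H := H) hdiff hH hxs
  set C := (1 + L / H) * (3 + 2 * L / H) ^ 2 with hC
  have hC0 : 0 < C := by positivity
  let w (ω : Ω) : ℕ × ℕ → Fin n := fun q => s q.1 q.2 ω
  let bad (k : ℕ) : Set Ω := {ω |
    auxObjective f H (runCentre f H Lc x₀ Nin k (w ω)) (runCentre f H Lc x₀ Nin k (w ω))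
        - auxObjective f H (runCentre f H Lc x₀ Nin k (w ω)) (m (runCentre f H Lc x₀ Nin k (w ω)))
      < (auxObjective f H (runCentre f H Lc x₀ Nin k (w ω)) (runInner f H Lc x₀ Nin k Nin (w ω))
        - auxObjective f H (runCentre f H Lc x₀ Nin k (w ω))
          (m (runCentre f H Lc x₀ Nin k (w ω)))) * C}
  have hbad (k : ℕ) (hk : k ∈ Finset.range Nout) : P.real (bad k) ≤ δ / Nout := by
    have hNout0 : (0 : ℝ) < Nout := by
      exact_mod_cast (Nat.zero_le k).trans_lt (Finset.mem_range.1 hk)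
    refine measureReal_residual_gt_le (s := fun q => s q.1 q.2) hdiff hconv hH hLc0 hLc hZ hHZ hm
      (fun q => hs_meas q.1 q.2) hs_indep (fun q => hs_law q.1 q.2) x₀ Nin k (by positivity) hC0 ?_
    rw [inv_div, hC, ← mul_assoc]
    exact_mod_cast Int.ceil_le.1 hNin
  have hunion : P.real (⋃ k ∈ Finset.range Nout, bad k) ≤ δ := by
    calc _ ≤ ∑ k ∈ Finset.range Nout, P.real (bad k) :=
          MeasureTheory.measureReal_biUnion_finset_le _ _
      _ ≤ ∑ k ∈ Finset.range Nout, δ / Nout := Finset.sum_le_sum hbad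
      _ ≤ δ := by
        rw [Finset.sum_const, Finset.card_range, nsmul_eq_mul]
        rcases eq_or_ne (Nout : ℝ) 0 with h | h
        · simp [h, hδ₀.le]
        · rw [mul_div_cancel₀ _ h]
  -- Covering the whole space and using subadditivity avoids any measurability claim about the
  -- success event.
  have hcover : (Set.univ : Set Ω) ⊆
      {ω | f (metaRun f H Lc x₀ Nin (fun k j => s k j ω) Nout).v - f xs < ε}
        ∪ ⋃ k ∈ Finset.range Nout, bad k := by
    intro ω _
    by_contra hω
    rw [Set.mem_union, not_or] at hω
    refine hω.1 (metaRun_sub_lt hdiff hconv hH xs hε Nout (by exact_mod_cast Int.ceil_le.1 hNout)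
      fun k hk => ?_)
    have hgood : ω ∉ bad k := fun h =>
      hω.2 (Set.mem_biUnion (Finset.mem_coe.2 (Finset.mem_range.2 hk)) h)
    exact norm_gradient_auxObjective_le_of_residual hdiff hconv hH hL0 hL (hm _) (not_lt.1 hgood)
  have htotal := (MeasureTheory.measureReal_mono hcover (μ := P)).trans
    (MeasureTheory.measureReal_union_le _ _)
  rw [MeasureTheory.probReal_univ] at htotal
  linarith
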